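/- Let $G$ be a finite simple graph with $n\ge 2$ vertices and $m$ edges, and let $k\ge 1$ be an integer. For a partition $\mathcal P$ of $V(G)$ into nonempty classes let $G/\mathcal P$ be the multigraph obtained by shrinking every class to a single vertex (edges inside a class are deleted, parallel edges are kept), so that $e(G/\mathcal P)$ is the number of edges of $G$ joining different classes, and put $$\tau(G)=\min_{|\mathcal P|\ge 2}\frac{e(G/\mathcal P)}{|\mathcal P|-1}.$$ An edge-coloring of $G$ (adjacent edges may have the same color) is an $RMC_k$-coloring if every two distinct vertices $u,v$ are connected by $k$ pairwise edge-disjoint $uv$-paths, each of which is monochromatic (all its edges have the same color), such that the colors of these $k$ paths are pairwise different. Let $rmc_k(G)$ be the maximum number of colors used by an $RMC_k$-coloring of $G$. **Theorem.** Suppose that $\tau(G)\ge k$ and that $G$ satisfies at least one of the following properties. Then $G$ has an $RMC_k$-coloring (so that $rmc_k(G)$ is defined), and $rmc_k(G)=m-k(n-2)$. 1. $G$ is triangle-free; 2. $\operatorname{diam}(G)\ge 3$; 3. $G$ has a cut vertex; 4. $G$ is not $(k+1)$-edge-connected, i.e. at most $k$ edges of $G$ can be deleted so that the remaining graph on $V(G)$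 is disconnected. -/

import Mathlib

namespace RainbowMono

/-- The number of edges of the (multi)graph `G / P` obtained from `G` by shrinking every class of
the partition `P` of the vertex set to a single vertex (parallel edges are kept, the edges inside
a class are deleted): it is the number of edges of `G` joining two different classes. -/
noncomputable def crossingCount {V : Type*} (G : SimpleGraph V) (P : Setoid V) : ℕ :=
  {e ∈ G.edgeSet | ∃ u v : V, e = s(u, v) ∧ ¬ P u v}.ncard

/-- `τ(G)`, the minimum of `e(G / P) / (|G / P| - 1)` over all partitions `P` of the vertex set
into at least two classes. For a finite graph with at least two vertices this is the infimum of a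
finite nonempty set of reals, hence a minimum. -/
noncomputable def tau {V : Type*} (G : SimpleGraph V) : ℝ :=
  sInf {x : ℝ | ∃ P : Setoid V, 2 ≤ Nat.card (Quotient P) ∧
    x = (crossingCount G P : ℝ) / ((Nat.card (Quotient P) : ℝ) - 1)}

/-- There are `k` rainbow monochromatic `uv`-paths: `k` pairwise edge-disjoint `uv`-paths,
each of them monochromatic, with pairwise different colors. -/
def HasRainbowMonoPaths {V : Type*} (G : SimpleGraph V) (Γ : G.EdgeLabeling ℕ) (k : ℕ)
    (u v : V) : Prop :=
  ∃ (p : Fin k → G.Path u v) (c : Fin k → ℕ),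
    (∀ i : Fin k, ∀ (e : Sym2 V) (he : e ∈ (p i : G.Walk u v).edges),
      Γ ⟨e, (p i : G.Walk u v).edges_subset_edgeSet he⟩ = c i) ∧
    Function.Injective c ∧
    ∀ i j : Fin k, i ≠ j → List.Disjoint (p i : G.Walk u v).edges (p j : G.Walk u v).edges

/-- `Γ` is a rainbow monochromatic `k`-edge-connection coloring of `G`. -/
def IsRMCColoring {V : Type*} (G : SimpleGraph V) (k : ℕ) (Γ : G.EdgeLabeling ℕ) : Prop :=
  ∀ u v : V, u ≠ v → HasRainbowMonoPaths G Γ k u v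

/-- The numbers of colors used by the rainbow monochromatic `k`-edge-connection colorings
of `G`. -/
def rmcColorCounts {V : Type*} (G : SimpleGraph V) (k : ℕ) : Set ℕ :=
  {c : ℕ | ∃ Γ : G.EdgeLabeling ℕ, IsRMCColoring G k Γ ∧ (Set.range Γ).ncard = c}

/-- `rmc_k(G)`: the maximum number of colors used by a rainbow monochromatic
`k`-edge-connection coloring of `G`. -/
noncomputable def rmc {V : Type*} (G : SimpleGraph V) (k : ℕ) : ℕ :=
  sSup (rmcColorCounts G k)

/-- `a` is a cut vertex of `G`: some two vertices other than `a` are connected in `G`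
but not in `G - a`. -/
def IsCutVertex {V : Type*} (G : SimpleGraph V) (a : V) : Prop :=
  ∃ u v : ({a}ᶜ : Set V), G.Reachable u v ∧ ¬ (G.induce ({a}ᶜ : Set V)).Reachable u v

end RainbowMono

/-!
For the lower bound on the number of colors, the hypothesis on `τ` gives `k` edge-disjoint spanning
trees (Tutte, Nash-Williams). Coloring each of them with a color of its own, and every other edge
with a further color, one uses `m - k (n - 1) + k` colors (`exists_isRMCColoring_of_connected`).

The tree packing is obtained from a partition of all edges into `k` classes with the fewest
components in total (`exists_forall_edgeClass_connected`). An edge which is not a bridge of its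
class can be moved to any other class; by minimality its ends are already connected there, so it
closes a cycle, whose edges become movable in turn. The edges which can be made movable form the
exchange graph. Every class spans each component of the exchange graph
(`reachable_edgeClass_of_exchangeGraph_adj`), whereas an edge outside of it is a bridge of its
class. Counting these bridges against the partition into the components of the exchange graph shows
that every class is connected.

For the upper bound, let `E c` be the set of edges of color `c`. As the classes `E c` partition the
edges, it is enough that the sum of `|E c| - 1` over all colors is at least `k (n - 2)`, and all
that is used about the coloring is that any two vertices are connected within at least `k` colors
(`le_card_filter_reachable`).

* If `G` is triangle-free or has diameter at least three, there are two vertices `u ≠ v` without a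
  common neighbor. Each of the other `n - 2` vertices gets one of `u` and `v` as a target, so that
  at most `|E c| - 1` vertices are connected to their target in color `c`
  (`card_reachable_add_one_le`); each vertex is so in at least `k` colors.
* If `a` is a cut vertex, separating `α` vertices from `β` others, and color `c` connects `x` and
  `y` of these to `a`, then `|E c| - 1 ≥ x + y - 1 ≥ (α + β - 1) x y / (α β)` whenever `x y > 0`,
  and the sum of the `x y` is at least `k α β`, since color `c` connects the two sides only via `a`.
* If at most `k` edges disconnect `G`, exactly `k` colors occur on them and each of these is
  connected and spanning.
-/

namespace RainbowMono
open SimpleGraph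

/-! ### Connected components and bridges -/

theorem reachable_of_forall_adj {V : Type*} {H K : SimpleGraph V}
    (h : ∀ x y, H.Adj x y → K.Reachable x y) {x y : V} (hxy : H.Reachable x y) :
    K.Reachable x y := by
  obtain ⟨p⟩ := hxy
  induction p with
  | nil => exact .rfl
  | cons hadj _ ih => exact (h _ _ hadj).trans ih

theorem exists_surjective_connectedComponent {V : Type*} {H K : SimpleGraph V}
    (h : ∀ x y, H.Adj x y → K.Reachable x y) :
    ∃ f : H.ConnectedComponent → K.ConnectedComponent, Function.Surjective f ∧
      ∀ x, f (H.connectedComponentMk x) = K.connectedComponentMk x :=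
  ⟨Quot.map id fun _ _ hxy ↦ reachable_of_forall_adj h hxy,
    fun c ↦ c.ind fun x ↦ ⟨H.connectedComponentMk x, rfl⟩, fun _ ↦ rfl⟩

theorem card_connectedComponent_le {V : Type*} [Finite V] {H K : SimpleGraph V}
    (h : ∀ x y, H.Adj x y → K.Reachable x y) :
    Nat.card K.ConnectedComponent ≤ Nat.card H.ConnectedComponent := by
  obtain ⟨f, hf, -⟩ := exists_surjective_connectedComponent h
  exact Nat.card_le_card_of_surjective f hf

theorem card_connectedComponent_lt {V : Type*} [Finite V] {H K : SimpleGraph V}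
    (h : ∀ x y, H.Adj x y → K.Reachable x y) {x y : V} (hK : K.Reachable x y)
    (hH : ¬ H.Reachable x y) :
    Nat.card K.ConnectedComponent < Nat.card H.ConnectedComponent := by
  obtain ⟨f, hf, hfx⟩ := exists_surjective_connectedComponent h
  refine lt_of_le_of_ne (Nat.card_le_card_of_surjective f hf) fun heq ↦ hH ?_
  have hinj := (hf.bijective_of_nat_card_le heq.ge).1
  refine ConnectedComponent.exact (hinj ?_)
  rw [hfx, hfx]
  exact ConnectedComponent.sound hK

/-- Deleting a set of bridges, one after the other, raises the number of components by one each
time, because the remaining ones stay bridges. -/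
theorem ncard_bridges_add_card_connectedComponent_le {V : Type*} [Finite V] {H K : SimpleGraph V}
    (hle : K ≤ H) (hbr : ∀ e ∈ H.edgeSet \ K.edgeSet, H.IsBridge e) :
    (H.edgeSet \ K.edgeSet).ncard + Nat.card H.ConnectedComponent ≤
      Nat.card K.ConnectedComponent := by
  induction hn : (H.edgeSet \ K.edgeSet).ncard generalizing H with
  | zero =>
    simpa using card_connectedComponent_le fun x y hxy ↦ (hle hxy).reachable
  | succ n ih =>
    obtain ⟨e, he⟩ : (H.edgeSet \ K.edgeSet).Nonempty := by
      rw [← Set.ncard_pos]; omega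
    have hset : (H.deleteEdges {e}).edgeSet \ K.edgeSet = (H.edgeSet \ K.edgeSet) \ {e} := by
      rw [edgeSet_deleteEdges, sdiff_right_comm]
    have hlt : Nat.card H.ConnectedComponent < Nat.card (H.deleteEdges {e}).ConnectedComponent := by
      have hb := hbr e he
      have hadj := he.1
      induction e with | h x y =>
      exact card_connectedComponent_lt (fun a b hab ↦ (deleteEdges_le _ hab).reachable)
        (Adj.reachable hadj) (isBridge_iff.1 hb)
    have := ih (H := H.deleteEdges {e}) (fun a b hab ↦ by
        rw [deleteEdges_adj]
        exact ⟨hle hab, fun h ↦ he.2 (Set.mem_singleton_iff.1 h ▸ hab)⟩)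
      (fun f hf ↦ (hbr f (by rw [hset] at hf; exact hf.1)).anti (deleteEdges_le _))
      (by rw [hset, Set.ncard_sdiff_singleton_of_mem he]; omega)
    omega

/-- The ends of an edge `e` that is not a bridge are joined by a path all of whose edges lie
on a common cycle with `e`, hence are no bridges either. -/
theorem reachable_fromEdgeSet_of_not_isBridge {V : Type*} {H : SimpleGraph V} {x y : V}
    (hxy : H.Adj x y) (hb : ¬ H.IsBridge s(x, y)) :
    (fromEdgeSet {f ∈ H.edgeSet | ¬ H.IsBridge f ∧ f ≠ s(x, y)}).Reachable x y := by
  classical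
  rw [isBridge_iff, not_not, reachable_deleteEdges_iff_exists_walk] at hb
  obtain ⟨p, hp⟩ := hb
  have hq : s(x, y) ∉ (p.toPath : H.Walk x y).edges :=
    fun h ↦ hp (Walk.edges_toPath_subset_edges p h)
  have hcyc : (Walk.cons hxy.symm (p.toPath : H.Walk x y)).IsCycle :=
    Path.cons_isCycle _ _ (by rwa [Sym2.eq_swap])
  refine ⟨(p.toPath : H.Walk x y).transfer _ fun f hf ↦ ?_⟩
  have hfH := (p.toPath : H.Walk x y).edges_subset_edgeSet hf
  rw [edgeSet_fromEdgeSet]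
  exact ⟨⟨hfH, fun h ↦ h.notMem_edges_of_isCycle hcyc (by simp [hf]),
    fun h ↦ hq (h ▸ hf)⟩, H.not_isDiag_of_mem_edgeSet hfH⟩

/-! ### Packing connected spanning subgraphs -/

/-- The subgraph of `G` formed by the edges to which `φ` gives the value `i`. Here `φ` is defined
on all unordered pairs; only its values on the edges of `G` matter. -/
def edgeClass {V α : Type*} (G : SimpleGraph V) (φ : Sym2 V → α) (i : α) : SimpleGraph V where
  Adj x y := G.Adj x y ∧ φ s(x, y) = i
  symm := ⟨fun x y h ↦ ⟨h.1.symm, by rw [Sym2.eq_swap]; exact h.2⟩⟩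
  loopless := ⟨fun x h ↦ G.loopless.irrefl x h.1⟩

theorem edgeClass_adj {V α : Type*} {G : SimpleGraph V} {φ : Sym2 V → α} {i : α} {x y : V} :
    (edgeClass G φ i).Adj x y ↔ G.Adj x y ∧ φ s(x, y) = i := Iff.rfl

theorem mem_edgeSet_edgeClass {V α : Type*} {G : SimpleGraph V} {φ : Sym2 V → α} {i : α}
    {e : Sym2 V} : e ∈ (edgeClass G φ i).edgeSet ↔ e ∈ G.edgeSet ∧ φ e = i := by
  induction e with | h x y => rfl

/-- An exchange step: one edge which is not a bridge of its class is put into another class. -/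
def ExchangeStep {V α : Type*} [DecidableEq V] (G : SimpleGraph V) (φ ψ : Sym2 V → α) : Prop :=
  ∃ x y : V, ∃ i : α, G.Adj x y ∧ ¬ (edgeClass G φ (φ s(x, y))).IsBridge s(x, y) ∧
    ψ = Function.update φ s(x, y) i

/-- The total number of components of all the classes. -/
noncomputable def totalComponents {V α : Type*} [Fintype α] (G : SimpleGraph V)
    (φ : Sym2 V → α) : ℕ :=
  ∑ i, Nat.card (edgeClass G φ i).ConnectedComponent

/-- The graph of those edges of `G` that some sequence of exchange steps starting at `φ` turns
into an edge that is not a bridge of its class. -/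
def exchangeGraph {V α : Type*} [DecidableEq V] (G : SimpleGraph V) (φ : Sym2 V → α) :
    SimpleGraph V where
  Adj x y := ∃ ψ, Relation.ReflTransGen (ExchangeStep G) φ ψ ∧ G.Adj x y ∧
    ¬ (edgeClass G ψ (ψ s(x, y))).IsBridge s(x, y)
  symm := ⟨fun x y ⟨ψ, h, hxy, hb⟩ ↦ ⟨ψ, h, hxy.symm, by rwa [Sym2.eq_swap]⟩⟩
  loopless := ⟨fun x ⟨_, _, h, _⟩ ↦ G.loopless.irrefl x h⟩

section Exchange

variable {V α : Type*} [DecidableEq V] {G : SimpleGraph V} {φ ψ : Sym2 V → α}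

theorem edgeClass_update_of_ne {x y a b : V} {i j : α} (hne : s(a, b) ≠ s(x, y)) :
    (edgeClass G (Function.update φ s(x, y) i) j).Adj a b ↔ (edgeClass G φ j).Adj a b := by
  rw [edgeClass_adj, edgeClass_adj, Function.update_of_ne hne]

theorem reachable_edgeClass_update {x y a b : V} {i j : α}
    (hb : ¬ (edgeClass G φ (φ s(x, y))).IsBridge s(x, y)) (hab : (edgeClass G φ j).Adj a b) :
    (edgeClass G (Function.update φ s(x, y) i) j).Reachable a b := by
  rw [isBridge_iff, not_not] at hb
  by_cases hne : s(a, b) = s(x, y)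
  · have hj : φ s(x, y) = j := hne ▸ hab.2
    have key : (edgeClass G (Function.update φ s(x, y) i) j).Reachable x y := by
      refine hb.mono fun c d hcd ↦ ?_
      rw [deleteEdges_adj] at hcd
      rw [edgeClass_update_of_ne (by simpa using hcd.2), ← hj]
      exact hcd.1
    obtain ⟨rfl, rfl⟩ | ⟨rfl, rfl⟩ := Sym2.eq_iff.1 hne
    · exact key
    · exact key.symm
  · exact ((edgeClass_update_of_ne hne).2 hab).reachable

variable [Finite V] [Fintype α]

theorem totalComponents_update_le {x y : V} {i : α}
    (hb : ¬ (edgeClass G φ (φ s(x, y))).IsBridge s(x, y)) :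
    totalComponents G (Function.update φ s(x, y) i) ≤ totalComponents G φ :=
  Finset.sum_le_sum fun _ _ ↦
    card_connectedComponent_le fun _ _ hab ↦ reachable_edgeClass_update hb hab

/-- If moving the edge `xy` into class `i` cannot lower the total number of components,
then `x` and `y` are already connected in class `i`. -/
theorem reachable_edgeClass_of_minimal
    (hmin : ∀ ψ : Sym2 V → α, totalComponents G φ ≤ totalComponents G ψ)
    {x y : V} (hxy : G.Adj x y) (hb : ¬ (edgeClass G φ (φ s(x, y))).IsBridge s(x, y)) (i : α) :
    (edgeClass G φ i).Reachable x y := by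
  by_contra hr
  refine (hmin (Function.update φ s(x, y) i)).not_gt (Finset.sum_lt_sum (fun _ _ ↦
    card_connectedComponent_le fun _ _ hab ↦ reachable_edgeClass_update hb hab)
    ⟨i, Finset.mem_univ _, card_connectedComponent_lt
      (fun _ _ hab ↦ reachable_edgeClass_update hb hab) (Adj.reachable (u := x) (v := y) ?_) hr⟩)
  exact ⟨hxy, by simp⟩

theorem minimal_of_reflTransGen
    (hmin : ∀ ψ : Sym2 V → α, totalComponents G φ ≤ totalComponents G ψ)
    (h : Relation.ReflTransGen (ExchangeStep G) φ ψ) :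
    ∀ χ : Sym2 V → α, totalComponents G ψ ≤ totalComponents G χ := by
  induction h with
  | refl => exact hmin
  | tail _ hs ih =>
    obtain ⟨x, y, i, hxy, hb, rfl⟩ := hs
    exact fun χ ↦ (totalComponents_update_le hb).trans (ih χ)

/-- After moving `xy` into class `i`, it closes a cycle there, all of whose edges belong to the
exchange graph; so `x` and `y` are connected by edges of class `i` in the exchange graph. -/
theorem reachable_edgeClass_exchangeGraph
    (hmin : ∀ ψ : Sym2 V → α, totalComponents G φ ≤ totalComponents G ψ)
    (h : Relation.ReflTransGen (ExchangeStep G) φ ψ) {x y : V} (hxy : G.Adj x y)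
    (hb : ¬ (edgeClass G ψ (ψ s(x, y))).IsBridge s(x, y)) (i : α) :
    (edgeClass (exchangeGraph G φ) ψ i).Reachable x y := by
  by_cases hi : ψ s(x, y) = i
  · exact Adj.reachable ⟨⟨ψ, h, hxy, hb⟩, hi⟩
  have hr := reachable_edgeClass_of_minimal (minimal_of_reflTransGen hmin h) hxy hb i
  set χ := Function.update ψ s(x, y) i with hχ
  have hφχ : Relation.ReflTransGen (ExchangeStep G) φ χ := h.tail ⟨x, y, i, hxy, hb, rfl⟩
  have hb' : ¬ (edgeClass G χ i).IsBridge s(x, y) := by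
    rw [isBridge_iff, not_not]
    refine hr.mono fun a b hab ↦ ?_
    have hne : s(a, b) ≠ s(x, y) := fun hne ↦ hi (hne ▸ hab.2)
    rw [deleteEdges_adj]
    exact ⟨(edgeClass_update_of_ne hne).2 hab, by simpa using hne⟩
  refine (reachable_fromEdgeSet_of_not_isBridge (H := edgeClass G χ i) ⟨hxy, by simp [hχ]⟩
    hb').mono fun a b hab ↦ ?_
  obtain ⟨⟨hab1, hab2, hne⟩, -⟩ := (fromEdgeSet_adj _).1 hab
  have hab3 : (edgeClass G χ i).Adj a b := hab1
  refine ⟨⟨χ, hφχ, hab3.1, ?_⟩, ((edgeClass_update_of_ne hne).1 hab3).2⟩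
  rw [hab3.2]
  exact hab2

/-- Each class spans every component of the exchange graph: undoing an exchange step, a moved edge
can be replaced by the path of `reachable_edgeClass_exchangeGraph`. -/
theorem reachable_edgeClass_of_exchangeGraph_adj
    (hmin : ∀ ψ : Sym2 V → α, totalComponents G φ ≤ totalComponents G ψ) (i : α) {x y : V}
    (hxy : (exchangeGraph G φ).Adj x y) : (edgeClass (exchangeGraph G φ) φ i).Reachable x y := by
  obtain ⟨ψ, h, hG, hb⟩ := hxy
  have key : ∀ a b, (edgeClass (exchangeGraph G φ) ψ i).Reachable a b →
      (edgeClass (exchangeGraph G φ) φ i).Reachable a b := by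
    clear hb
    induction h with
    | refl => exact fun _ _ h ↦ h
    | @tail χ _ hχ hs ih =>
      obtain ⟨x, y, j, hxy, hb, rfl⟩ := hs
      refine fun a b hab ↦ ih a b (reachable_of_forall_adj (fun c d hcd ↦ ?_) hab)
      by_cases hne : s(c, d) = s(x, y)
      · have := reachable_edgeClass_exchangeGraph hmin hχ hxy hb i
        obtain ⟨rfl, rfl⟩ | ⟨rfl, rfl⟩ := Sym2.eq_iff.1 hne
        · exact this
        · exact this.symm
      · exact ((edgeClass_update_of_ne hne).1 hcd).reachable
  exact key x y (reachable_edgeClass_exchangeGraph hmin h hG hb i)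

end Exchange

/-- The Tutte–Nash-Williams theorem, in the form of a packing of `k` connected spanning
subgraphs that together contain all edges. -/
theorem exists_forall_edgeClass_connected {V : Type*} [Finite V] [Nonempty V] (G : SimpleGraph V)
    {k : ℕ} (hk : 1 ≤ k)
    (hP : ∀ P : Setoid V, k * Nat.card (Quotient P) ≤ crossingCount G P + k) :
    ∃ φ : Sym2 V → Fin k, ∀ i, (edgeClass G φ i).Connected := by
  classical
  have : Nonempty (Fin k) := ⟨⟨0, hk⟩⟩
  obtain ⟨φ, hmin⟩ := Finite.exists_min (totalComponents G : (Sym2 V → Fin k) → ℕ)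
  refine ⟨φ, ?_⟩
  set D := exchangeGraph G φ with hD
  have hDG : D ≤ G := fun x y ⟨_, _, h, _⟩ ↦ h
  -- the edges outside the exchange graph are bridges of their classes
  have hbridge (i : Fin k) : ∀ e ∈ (edgeClass G φ i).edgeSet \ (edgeClass D φ i).edgeSet,
      (edgeClass G φ i).IsBridge e := by
    rintro e ⟨he, heD⟩
    by_contra hb
    rw [mem_edgeSet_edgeClass] at he heD
    refine heD ⟨?_, he.2⟩
    induction e with | h x y =>
    exact ⟨φ, .refl, he.1, by rwa [he.2]⟩
  have hcount (i : Fin k) : ((edgeClass G φ i).edgeSet \ (edgeClass D φ i).edgeSet).ncard +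
      Nat.card (edgeClass G φ i).ConnectedComponent ≤ Nat.card D.ConnectedComponent :=
    (ncard_bridges_add_card_connectedComponent_le (H := edgeClass G φ i) (K := edgeClass D φ i)
      (fun _ _ h ↦ ⟨hDG h.1, h.2⟩) (hbridge i)).trans
      (card_connectedComponent_le fun x y h ↦ reachable_edgeClass_of_exchangeGraph_adj hmin i h)
  have hcross : crossingCount G D.reachableSetoid ≤
      ∑ i, ((edgeClass G φ i).edgeSet \ (edgeClass D φ i).edgeSet).ncard := by
    have hsub : {e ∈ G.edgeSet | ∃ u v : V, e = s(u, v) ∧ ¬ D.reachableSetoid u v} ⊆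
        ⋃ i ∈ (Finset.univ : Finset (Fin k)),
          ((edgeClass G φ i).edgeSet \ (edgeClass D φ i).edgeSet) := by
      rintro e ⟨he, u, v, rfl, huv⟩
      simp only [Finset.mem_univ, Set.iUnion_true, Set.mem_iUnion]
      exact ⟨φ s(u, v), ⟨he, rfl⟩, fun h ↦ huv (Adj.reachable (mem_edgeSet_edgeClass.1 h).1)⟩
    exact (Set.ncard_le_ncard hsub (Set.toFinite _)).trans
      (Finset.set_ncard_biUnion_le _ _)
  have hsum := Finset.sum_le_sum fun i (_ : i ∈ Finset.univ) ↦ hcount i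
  rw [Finset.sum_add_distrib, Finset.sum_const, Finset.card_univ, Fintype.card_fin,
    smul_eq_mul] at hsum
  have hPD : k * Nat.card D.ConnectedComponent ≤ crossingCount G D.reachableSetoid + k :=
    hP D.reachableSetoid
  have hpos (i : Fin k) : 1 ≤ Nat.card (edgeClass G φ i).ConnectedComponent := Nat.card_pos
  have hone (i : Fin k) : Nat.card (edgeClass G φ i).ConnectedComponent = 1 := by
    by_contra hne
    have : ∑ _i : Fin k, 1 < ∑ i, Nat.card (edgeClass G φ i).ConnectedComponent :=
      Finset.sum_lt_sum (fun i _ ↦ hpos i)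
        ⟨i, Finset.mem_univ _, lt_of_le_of_ne (hpos i) (Ne.symm hne)⟩
    simp only [Finset.sum_const, Finset.card_univ, Fintype.card_fin, smul_eq_mul, mul_one] at this
    omega
  intro i
  have := (Nat.card_eq_one_iff_unique.1 (hone i)).1
  exact ⟨fun x y ↦ ConnectedComponent.exact (Subsingleton.elim _ _)⟩

/-! ### A coloring with many colors -/

theorem mul_card_quotient_le_of_le_tau {V : Type*} {G : SimpleGraph V} {k : ℕ}
    (hτ : (k : ℝ) ≤ tau G) (P : Setoid V) :
    k * Nat.card (Quotient P) ≤ crossingCount G P + k := by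
  rcases Nat.lt_or_ge (Nat.card (Quotient P)) 2 with h | h
  · have : k * Nat.card (Quotient P) ≤ k * 1 := Nat.mul_le_mul_left _ (by omega)
    omega
  have hbdd : BddBelow {x : ℝ | ∃ P : Setoid V, 2 ≤ Nat.card (Quotient P) ∧
      x = (crossingCount G P : ℝ) / ((Nat.card (Quotient P) : ℝ) - 1)} := by
    refine ⟨0, ?_⟩
    rintro _ ⟨Q, hQ, rfl⟩
    have : (2 : ℝ) ≤ Nat.card (Quotient Q) := by exact_mod_cast hQ
    exact div_nonneg (Nat.cast_nonneg _) (by linarith)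
  have hle := hτ.trans (csInf_le hbdd ⟨P, h, rfl⟩)
  have h2 : (2 : ℝ) ≤ Nat.card (Quotient P) := by exact_mod_cast h
  rw [le_div_iff₀ (by linarith)] at hle
  have : (k : ℝ) * Nat.card (Quotient P) ≤ crossingCount G P + k := by linarith
  exact_mod_cast this

/-- Color the spanning tree chosen in the class `i` with the color `i`, and all the other edges
with new and pairwise different colors. -/
theorem exists_isRMCColoring_of_connected {V : Type*} [Finite V] [Nontrivial V]
    (G : SimpleGraph V) {k : ℕ} (φ : Sym2 V → Fin k) (hφ : ∀ i, (edgeClass G φ i).Connected) :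
    ∃ Γ : G.EdgeLabeling ℕ, IsRMCColoring G k Γ ∧
      G.edgeSet.ncard + 2 * k ≤ (Set.range Γ).ncard + k * Nat.card V := by
  classical
  choose T hT hTree using fun i ↦ (hφ i).exists_isTree_le
  have hTφ {i : Fin k} {e : Sym2 V} (he : e ∈ (T i).edgeSet) : e ∈ G.edgeSet ∧ φ e = i :=
    mem_edgeSet_edgeClass.1 (edgeSet_mono (hT i) he)
  obtain ⟨idx, hidx⟩ := Countable.exists_injective_nat (Sym2 V)
  let Γ : G.EdgeLabeling ℕ := fun e ↦
    if (e : Sym2 V) ∈ (T (φ e)).edgeSet then (φ e : ℕ) else k + idx e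
  have hΓ {i : Fin k} {e : Sym2 V} (he : e ∈ (T i).edgeSet) (heG : e ∈ G.edgeSet) :
      Γ ⟨e, heG⟩ = i := by
    obtain ⟨-, rfl⟩ := hTφ he
    exact if_pos he
  refine ⟨Γ, fun u v _ ↦ ?_, ?_⟩
  · choose p hp using fun i ↦ ((hTree i).connected u v).exists_isPath
    have hpG (i : Fin k) : ∀ e ∈ (p i).edges, e ∈ G.edgeSet :=
      fun e he ↦ (hTφ ((p i).edges_subset_edgeSet he)).1
    refine ⟨fun i ↦ ⟨(p i).transfer G (hpG i), (hp i).transfer _⟩, fun i ↦ i, ?_,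
      Fin.val_injective, ?_⟩
    · intro i e he
      exact hΓ ((p i).edges_subset_edgeSet (by simpa using he)) _
    · intro i j hij e hei hej
      simp only [Walk.edges_transfer] at hei hej
      exact hij ((hTφ ((p i).edges_subset_edgeSet hei)).2.symm.trans
        (hTφ ((p j).edges_subset_edgeSet hej)).2)
  · set A : Set (Sym2 V) := {e | e ∈ (T (φ e)).edgeSet} with hA
    have hAcard : A.ncard + k ≤ k * Nat.card V := by
      have hsub : A ⊆ ⋃ i ∈ (Finset.univ : Finset (Fin k)), (T i).edgeSet := by
        intro e he
        simp only [Finset.mem_univ, Set.iUnion_true, Set.mem_iUnion]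
        exact ⟨_, he⟩
      have h1 : A.ncard ≤ ∑ i, (T i).edgeSet.ncard :=
        (Set.ncard_le_ncard hsub (Set.toFinite _)).trans (Finset.set_ncard_biUnion_le _ _)
      have h2 (i : Fin k) : (T i).edgeSet.ncard + 1 = Nat.card V :=
        (isTree_iff_connected_and_card.1 (hTree i)).2
      have h3 : ∑ i, ((T i).edgeSet.ncard + 1) = k * Nat.card V := by simp [h2]
      rw [Finset.sum_add_distrib] at h3
      simp at h3
      omega
    have hsub : (Fin.val '' (Set.univ : Set (Fin k))) ∪
        ((fun e ↦ k + idx e) '' (G.edgeSet \ A)) ⊆ Set.range Γ := by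
      rintro _ (⟨i, -, rfl⟩ | ⟨e, ⟨heG, heA⟩, rfl⟩)
      · obtain ⟨x, y, hxy⟩ := exists_pair_ne V
        obtain ⟨z, hz⟩ := (hTree i).connected.preconnected.exists_adj_of_nontrivial x
        exact ⟨⟨s(x, z), (hTφ (e := s(x, z)) hz).1⟩, hΓ (e := s(x, z)) hz _⟩
      · exact ⟨⟨e, heG⟩, if_neg heA⟩
    have hdisj : Disjoint (Fin.val '' (Set.univ : Set (Fin k)))
        ((fun e ↦ k + idx e) '' (G.edgeSet \ A)) := by
      rw [Set.disjoint_left]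
      rintro _ ⟨i, -, rfl⟩ ⟨e, -, he⟩
      have := i.2
      simp only at he
      omega
    have hcard := Set.ncard_le_ncard hsub (Set.toFinite _)
    rw [Set.ncard_union_eq hdisj (Set.toFinite _) (Set.toFinite _),
      Set.ncard_image_of_injective _ Fin.val_injective,
      Set.ncard_image_of_injective _ (fun a b hab ↦ hidx (Nat.add_left_cancel hab)),
      Set.ncard_univ, Nat.card_fin] at hcard
    have := Set.ncard_le_ncard_sdiff_add_ncard G.edgeSet A (Set.toFinite _)
    omega

/-! ### Counting the edges of each color -/

/-- If every vertex of `F` is assigned a different vertex of its component of `H` as a root, the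
same for all vertices of `F` in the component, then `H` has at least `F.card` edges: send each
vertex of `F` to the first edge of a shortest path to its root. -/
theorem card_le_ncard_edgeSet_of_roots {V : Type*} [Finite V] {H : SimpleGraph V} (F : Finset V)
    (r : V → V) (hne : ∀ w ∈ F, w ≠ r w) (hreach : ∀ w ∈ F, H.Reachable w (r w))
    (hroot : ∀ w ∈ F, ∀ w' ∈ F, H.Reachable w w' → r w = r w') :
    F.card ≤ H.edgeSet.ncard := by
  have hex (w : V) : ∃ p, w ∈ F → H.Adj w p ∧ H.dist p (r w) < H.dist w (r w) := by
    by_cases hw : w ∈ F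
    · obtain ⟨q, hq⟩ := (hreach w hw).exists_walk_length_eq_dist
      have hnil := hne w hw
      generalize r w = t at q hq hnil ⊢
      cases q with
      | nil => exact absurd rfl hnil
      | @cons _ p _ hadj q' =>
        refine ⟨p, fun _ ↦ ⟨hadj, ?_⟩⟩
        have := dist_le q'
        rw [Walk.length_cons] at hq
        omega
    · exact ⟨w, fun h ↦ absurd h hw⟩
  choose p hp using hex
  rw [← Set.ncard_coe_finset]
  refine Set.ncard_le_ncard_of_injOn (fun w ↦ s(w, p w)) (fun w hw ↦ (hp w hw).1) ?_
    (Set.toFinite _)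
  intro w hw w' hw' heq
  obtain ⟨h, -⟩ | ⟨h1, h2⟩ := Sym2.eq_iff.1 heq
  · exact h
  · have hr := hroot w hw w' hw' (h2 ▸ (hp w hw).1.reachable)
    have ha := (hp w hw).2
    have hb := (hp w' hw').2
    rw [h2, hr] at ha
    rw [← h1] at hb
    omega

section Coloring

variable {V : Type*} {G : SimpleGraph V} {k : ℕ} {Γ : G.EdgeLabeling ℕ}

theorem mem_edgeSet_labelGraph {c : ℕ} {e : Sym2 V} :
    e ∈ (Γ.labelGraph c).edgeSet ↔ ∃ h : e ∈ G.edgeSet, Γ ⟨e, h⟩ = c := by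
  induction e with | h x y => exact EdgeLabeling.labelGraph_adj x y

theorem nonempty_edgeSet_labelGraph {c : ℕ} (hc : c ∈ Set.range Γ) :
    (Γ.labelGraph c).edgeSet.Nonempty := by
  obtain ⟨⟨e, he⟩, rfl⟩ := hc
  exact ⟨e, mem_edgeSet_labelGraph.2 ⟨he, rfl⟩⟩

theorem sum_ncard_edgeSet_labelGraph_le [Finite V] (C : Finset ℕ) :
    ∑ c ∈ C, (Γ.labelGraph c).edgeSet.ncard ≤ G.edgeSet.ncard := by
  classical
  have hdisj : (C : Set ℕ).PairwiseDisjoint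
      fun c ↦ (Set.toFinite (Γ.labelGraph c).edgeSet).toFinset := by
    intro c _ d _ hcd
    rw [Function.onFun, Finset.disjoint_left]
    intro e hc hd
    rw [Set.Finite.mem_toFinset, mem_edgeSet_labelGraph] at hc hd
    obtain ⟨h, rfl⟩ := hc
    obtain ⟨h', rfl⟩ := hd
    exact hcd rfl
  simp only [Set.ncard_eq_toFinset_card _ (Set.toFinite _)]
  rw [← Finset.card_biUnion hdisj]
  refine Finset.card_le_card fun e he ↦ ?_
  simp only [Finset.mem_biUnion, Set.Finite.mem_toFinset, mem_edgeSet_labelGraph] at he ⊢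
  obtain ⟨_, _, h, _⟩ := he
  exact h

/-- The number of colors is bounded as soon as every color `c` is known to have more than `g c`
edges. -/
theorem ncard_range_add_sum_le [Finite V] (C : Finset ℕ) (hC : (C : Set ℕ) = Set.range Γ)
    (g : ℕ → ℕ)
    (hg : ∀ c ∈ C, g c + 1 ≤ (Γ.labelGraph c).edgeSet.ncard) :
    (Set.range Γ).ncard + ∑ c ∈ C, g c ≤ G.edgeSet.ncard := by
  have h1 := Finset.sum_le_sum hg
  rw [Finset.sum_add_distrib, Finset.sum_const, smul_eq_mul, mul_one] at h1
  have h2 := sum_ncard_edgeSet_labelGraph_le (Γ := Γ) C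
  rw [← hC, Set.ncard_coe_finset]
  omega

/-- Only the colors connecting two vertices matter for `HasRainbowMonoPaths`: there have to be at
least `k` of them. -/
theorem le_card_filter_reachable (C : Finset ℕ) (hC : (C : Set ℕ) = Set.range Γ) {u v : V}
    [DecidablePred fun c ↦ (Γ.labelGraph c).Reachable u v] (huv : u ≠ v)
    (h : HasRainbowMonoPaths G Γ k u v) :
    k ≤ (C.filter fun c ↦ (Γ.labelGraph c).Reachable u v).card := by
  obtain ⟨p, c, hp, hc, -⟩ := h
  have hr (i : Fin k) : (Γ.labelGraph (c i)).Reachable u v :=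
    ⟨(p i : G.Walk u v).transfer _ fun e he ↦ mem_edgeSet_labelGraph.2 ⟨_, hp i e he⟩⟩
  have hmem (i : Fin k) : c i ∈ C := by
    rw [← Finset.mem_coe, hC]
    cases hq : (p i : G.Walk u v) with
    | nil => exact absurd rfl huv
    | @cons _ w _ hadj q => exact ⟨⟨s(u, w), hadj⟩, hp i s(u, w) (by rw [hq]; simp)⟩
  calc k = (Finset.univ.image c).card := by
        rw [Finset.card_image_of_injective _ hc, Finset.card_univ, Fintype.card_fin]
    _ ≤ _ := Finset.card_le_card fun d hd ↦ by
        obtain ⟨i, -, rfl⟩ := Finset.mem_image.1 hd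
        exact Finset.mem_filter.2 ⟨hmem i, hr i⟩

end Coloring

/-! ### Two vertices without a common neighbor -/

/-- The target `f w` of a vertex `w` is one of `u` and `v` that is not adjacent to it, and `H` has
more edges than there are vertices connected to their target. If `H` connects `u` and `v`, a
spanning tree of that component has one edge to spare. Otherwise, if any vertex is connected to its
target, say to `u`, then `u` has a neighbor in `H`. The target of this neighbor is `v`, so it is not
counted itself, but it accounts for one more edge. -/
theorem card_reachable_add_one_le {V : Type*} [Finite V] {G H : SimpleGraph V} (hH : H ≤ G)
    {u v : V} (huv : u ≠ v) (hno : ∀ w, G.Adj u w → ¬ G.Adj v w) (hE : H.edgeSet.Nonempty)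
    {f : V → V} (hfu : ∀ w, G.Adj v w → f w = u) (hfv : ∀ w, ¬ G.Adj v w → f w = v)
    {S : Finset V} (hS : ∀ w ∈ S, (w ≠ u ∧ w ≠ v) ∧ H.Reachable w (f w)) :
    S.card + 1 ≤ H.edgeSet.ncard := by
  classical
  have hf (w : V) : f w = u ∨ f w = v :=
    (em (G.Adj v w)).imp (hfu w) (hfv w)
  by_cases hr : H.Reachable u v
  · have huS : u ∉ S := fun h ↦ (hS u h).1.1 rfl
    rw [← Finset.card_insert_of_notMem huS]
    refine card_le_ncard_edgeSet_of_roots _ (fun _ ↦ v) (fun w hw ↦ ?_) (fun w hw ↦ ?_)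
      (fun _ _ _ _ _ ↦ rfl)
    · obtain rfl | hw := Finset.mem_insert.1 hw
      · exact huv
      · exact (hS w hw).1.2
    · obtain rfl | hw := Finset.mem_insert.1 hw
      · exact hr
      · have := (hS w hw).2
        obtain h | h := hf w <;> rw [h] at this
        · exact this.trans hr
        · exact this
  rcases S.eq_empty_or_nonempty with hS0 | ⟨w₀, hw₀⟩
  · rw [hS0, Finset.card_empty, zero_add]
    exact (Set.ncard_pos).2 hE
  obtain ⟨b, hbS, hbu, hbv, hb⟩ : ∃ b, b ∉ S ∧ b ≠ u ∧ b ≠ v ∧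
      (H.Reachable b u ∨ H.Reachable b v) := by
    obtain ⟨⟨hu, hv⟩, hw⟩ := hS w₀ hw₀
    obtain h₀ | h₀ := hf w₀ <;> rw [h₀] at hw
    · obtain ⟨q⟩ := hw.symm
      cases q with
      | nil => exact absurd rfl hu
      | @cons _ b _ hub _ =>
        have hbu : H.Reachable b u := hub.symm.reachable
        refine ⟨b, fun h ↦ ?_, hub.ne', ?_, .inl hbu⟩
        · have := (hS b h).2
          rw [hfv b (hno b (hH hub))] at this
          exact hr (hbu.symm.trans this)
        · rintro rfl
          exact hr hbu.symm
    · obtain ⟨q⟩ := hw.symm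
      cases q with
      | nil => exact absurd rfl hv
      | @cons _ b _ hvb _ =>
        have hbv : H.Reachable b v := hvb.symm.reachable
        refine ⟨b, fun h ↦ ?_, ?_, hvb.ne', .inr hbv⟩
        · have := (hS b h).2
          rw [hfu b (hH hvb)] at this
          exact hr (this.symm.trans hbv)
        · rintro rfl
          exact hr hbv
  rw [← Finset.card_insert_of_notMem hbS]
  have hF : ∀ w ∈ insert b S, (w ≠ u ∧ w ≠ v) ∧ (H.Reachable w u ∨ H.Reachable w v) := by
    intro w hw
    obtain rfl | hw := Finset.mem_insert.1 hw
    · exact ⟨⟨hbu, hbv⟩, hb⟩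
    · obtain ⟨h1, h2⟩ := hS w hw
      obtain h | h := hf w <;> rw [h] at h2
      exacts [⟨h1, .inl h2⟩, ⟨h1, .inr h2⟩]
  refine card_le_ncard_edgeSet_of_roots _ (fun w ↦ if H.Reachable w v then v else u)
    (fun w hw ↦ ?_) (fun w hw ↦ ?_) (fun w _ w' _ hww' ↦ ?_)
  · split_ifs
    exacts [(hF w hw).1.2, (hF w hw).1.1]
  · split_ifs with h
    exacts [h, (hF w hw).2.resolve_right h]
  · have : H.Reachable w v ↔ H.Reachable w' v := ⟨hww'.symm.trans, hww'.trans⟩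
    simp only [this]

theorem card_filter_ne_ne_add_two {V : Type*} [Fintype V] [DecidableEq V] {u v : V} (huv : u ≠ v) :
    (Finset.univ.filter fun w : V ↦ w ≠ u ∧ w ≠ v).card + 2 = Fintype.card V := by
  have h : (Finset.univ.filter fun w : V ↦ w ≠ u ∧ w ≠ v) = ({u, v} : Finset V)ᶜ := by
    ext w; simp
  rw [h, Finset.card_compl, Finset.card_pair huv]
  have := Finset.card_le_univ ({u, v} : Finset V)
  rw [Finset.card_pair huv] at this
  omega

theorem ncard_range_le_of_no_common_neighbor {V : Type*} [Finite V] {G : SimpleGraph V} {k : ℕ}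
    {Γ : G.EdgeLabeling ℕ} (hΓ : IsRMCColoring G k Γ) {u v : V} (huv : u ≠ v)
    (hno : ∀ w, G.Adj u w → ¬ G.Adj v w) :
    (Set.range Γ).ncard + k * Nat.card V ≤ G.edgeSet.ncard + 2 * k := by
  classical
  have := Fintype.ofFinite V
  set C := (Set.finite_range Γ).toFinset
  have hC : (C : Set ℕ) = Set.range Γ := Set.Finite.coe_toFinset _
  set f : V → V := fun w ↦ if G.Adj v w then u else v
  set W := Finset.univ.filter fun w : V ↦ w ≠ u ∧ w ≠ v
  have hW : W.card + 2 = Nat.card V := by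
    rw [Nat.card_eq_fintype_card]; exact card_filter_ne_ne_add_two huv
  have h1 := ncard_range_add_sum_le C hC
    (fun c ↦ (W.filter fun w ↦ (Γ.labelGraph c).Reachable w (f w)).card) (fun c hc ↦ by
      exact card_reachable_add_one_le Γ.labelGraph_le huv hno
        (nonempty_edgeSet_labelGraph (by rw [← hC]; exact hc))
        (fun _ h ↦ if_pos h) (fun _ h ↦ if_neg h)
        fun w hw ↦ ⟨(Finset.mem_filter.1 (Finset.mem_filter.1 hw).1).2,
          (Finset.mem_filter.1 hw).2⟩)
  have h2 : ∑ c ∈ C, (W.filter fun w ↦ (Γ.labelGraph c).Reachable w (f w)).card =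
      ∑ w ∈ W, (C.filter fun c ↦ (Γ.labelGraph c).Reachable w (f w)).card :=
    Finset.sum_card_bipartiteAbove_eq_sum_card_bipartiteBelow
      fun c w ↦ (Γ.labelGraph c).Reachable w (f w)
  have h3 : W.card * k ≤ ∑ w ∈ W, (C.filter fun c ↦ (Γ.labelGraph c).Reachable w (f w)).card := by
    rw [← smul_eq_mul]
    refine Finset.card_nsmul_le_sum _ _ _ fun w hw ↦ ?_
    have hw' := (Finset.mem_filter.1 hw).2
    have hne : w ≠ f w := by
      simp only [f]; split_ifs
      exacts [hw'.1, hw'.2]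
    exact le_card_filter_reachable C hC hne (hΓ w (f w) hne)
  rw [← hW]
  nlinarith

/-! ### Cut vertices -/

/-- If `a` is the only vertex outside `A` that has neighbors in `A`, a path leaving `A`
meets `a`. -/
theorem reachable_of_separated {V : Type*} {G H : SimpleGraph V} (hH : H ≤ G) {a : V}
    {A : Set V} (hA : ∀ x ∈ A, ∀ y, G.Adj x y → y ∈ A ∨ y = a) {p q : V} (hp : p ∈ A)
    (hq : q ∉ A) (h : H.Reachable p q) : H.Reachable p a := by
  obtain ⟨w⟩ := h
  induction w with
  | nil => exact absurd hp hq
  | cons hadj _ ih =>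
    obtain hy | rfl := hA _ hp _ (hH hadj)
    · exact hadj.reachable.trans (ih hy hq)
    · exact hadj.reachable

/-- The quotient `(x + y - 1) / (x * y) = 1 - (1 - 1 / x) * (1 - 1 / y)` decreases when `x` and `y`
grow. -/
theorem add_sub_one_mul_le {x y α β : ℤ} (hx : 1 ≤ x) (hy : 1 ≤ y) (hxα : x ≤ α) (hyβ : y ≤ β) :
    (α + β - 1) * (x * y) ≤ α * β * (x + y - 1) := by
  have h1 : (x - 1) * α ≤ (α - 1) * x := by linarith
  have h2 : (y - 1) * β ≤ (β - 1) * y := by linarith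
  have h3 : (x - 1) * α * ((y - 1) * β) ≤ (α - 1) * x * ((β - 1) * y) :=
    mul_le_mul h1 h2 (mul_nonneg (by linarith) (by linarith))
      (mul_nonneg (by linarith) (by linarith))
  linarith

/-- The vertex `a` separates `A` from the remaining vertices. The pairs of vertices on different
sides are counted by the colors connecting them, which also connect both of them to `a`. -/
theorem ncard_range_le_of_separated {V : Type*} [Finite V] {G : SimpleGraph V} {k : ℕ}
    {Γ : G.EdgeLabeling ℕ} (hΓ : IsRMCColoring G k Γ) {a u v : V} {A : Set V}
    (hA : ∀ x ∈ A, ∀ y, G.Adj x y → y ∈ A ∨ y = a) (haA : a ∉ A) (hu : u ∈ A) (hv : v ∉ A)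
    (hva : v ≠ a) : (Set.range Γ).ncard + k * Nat.card V ≤ G.edgeSet.ncard + 2 * k := by
  classical
  have := Fintype.ofFinite V
  set C := (Set.finite_range Γ).toFinset
  have hC : (C : Set ℕ) = Set.range Γ := Set.Finite.coe_toFinset _
  set S := Finset.univ.filter fun w ↦ w ∈ A with hS
  set T := Finset.univ.filter fun w ↦ w ∉ A ∧ w ≠ a with hT
  have hST : S.card + T.card + 1 = Nat.card V := by
    have h1 : Finset.univ.filter (fun w ↦ w ∉ A) = insert a T := by
      ext w
      by_cases hw : w = a <;> simp [hT, hw, haA]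
    have h2 := Finset.card_filter_add_card_filter_not (s := (Finset.univ : Finset V)) (· ∈ A)
    rw [h1, Finset.card_insert_of_notMem (by simp [hT]), Finset.card_univ] at h2
    rw [Nat.card_eq_fintype_card]
    omega
  set S' := fun c ↦ S.filter fun w ↦ (Γ.labelGraph c).Reachable w a with hS'
  set T' := fun c ↦ T.filter fun w ↦ (Γ.labelGraph c).Reachable w a with hT'
  have hedges (c : ℕ) : (S' c).card + (T' c).card ≤ (Γ.labelGraph c).edgeSet.ncard := by
    have hd : Disjoint (S' c) (T' c) := by
      rw [Finset.disjoint_left]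
      intro w h1 h2
      simp only [hS', hT', hS, hT, Finset.mem_filter] at h1 h2
      exact h2.1.2.1 h1.1.2
    rw [← Finset.card_union_of_disjoint hd]
    refine card_le_ncard_edgeSet_of_roots _ (fun _ ↦ a) (fun w hw ↦ ?_) (fun w hw ↦ ?_)
      (fun _ _ _ _ _ ↦ rfl)
    · simp only [hS', hT', hS, hT, Finset.mem_union, Finset.mem_filter] at hw
      rintro rfl
      obtain hw | hw := hw
      exacts [haA hw.1.2, hw.1.2.2 rfl]
    · simp only [hS', hT', Finset.mem_union, Finset.mem_filter] at hw
      obtain hw | hw := hw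
      exacts [hw.2, hw.2]
  have hcolor (c : ℕ) (hc : c ∈ C) :
      ((S.card : ℤ) + T.card - 1) * ((S' c).card * (T' c).card) ≤
        S.card * T.card * ((Γ.labelGraph c).edgeSet.ncard - 1) := by
    have hpos : (1 : ℤ) ≤ (Γ.labelGraph c).edgeSet.ncard := by
      exact_mod_cast (Set.ncard_pos).2
        (nonempty_edgeSet_labelGraph (Γ := Γ) (c := c) (by rw [← hC]; exact hc))
    have hnn : (0 : ℤ) ≤ S.card * T.card * ((Γ.labelGraph c).edgeSet.ncard - 1) :=
      mul_nonneg (by positivity) (by linarith)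
    rcases Nat.eq_zero_or_pos (S' c).card with h0 | hx
    · simpa [h0] using hnn
    rcases Nat.eq_zero_or_pos (T' c).card with h0 | hy
    · simpa [h0] using hnn
    have hx' : (1 : ℤ) ≤ (S' c).card := by exact_mod_cast hx
    have hy' : (1 : ℤ) ≤ (T' c).card := by exact_mod_cast hy
    have hxα : ((S' c).card : ℤ) ≤ S.card := by exact_mod_cast Finset.card_filter_le _ _
    have hyβ : ((T' c).card : ℤ) ≤ T.card := by exact_mod_cast Finset.card_filter_le _ _
    refine (add_sub_one_mul_le hx' hy' hxα hyβ).trans ?_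
    have he : ((S' c).card : ℤ) + (T' c).card ≤ (Γ.labelGraph c).edgeSet.ncard := by
      exact_mod_cast hedges c
    exact mul_le_mul_of_nonneg_left (by linarith) (by positivity)
  have hpairs : (S.card * T.card) * k ≤ ∑ c ∈ C, (S' c).card * (T' c).card := by
    have h1 (c : ℕ) : ((S ×ˢ T).filter fun z ↦ (Γ.labelGraph c).Reachable z.1 z.2).card ≤
        (S' c).card * (T' c).card := by
      rw [← Finset.card_product]
      refine Finset.card_le_card fun z hz ↦ ?_
      simp only [hS', hT', hS, hT, Finset.mem_filter, Finset.mem_product, Finset.mem_univ,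
        true_and] at hz ⊢
      obtain ⟨⟨hz1, hz2⟩, hz3⟩ := hz
      have := reachable_of_separated Γ.labelGraph_le hA hz1 hz2.1 hz3
      exact ⟨⟨hz1, this⟩, hz2, hz3.symm.trans this⟩
    refine le_trans ?_ (Finset.sum_le_sum fun c _ ↦ h1 c)
    have h2 : ∑ c ∈ C, ((S ×ˢ T).filter fun z ↦ (Γ.labelGraph c).Reachable z.1 z.2).card =
        ∑ z ∈ S ×ˢ T, (C.filter fun c ↦ (Γ.labelGraph c).Reachable z.1 z.2).card :=
      Finset.sum_card_bipartiteAbove_eq_sum_card_bipartiteBelow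
        fun c (z : V × V) ↦ (Γ.labelGraph c).Reachable z.1 z.2
    rw [h2, ← Finset.card_product, ← smul_eq_mul]
    refine Finset.card_nsmul_le_sum _ _ _ fun z hz ↦ ?_
    simp only [hS, hT, Finset.mem_filter, Finset.mem_product, Finset.mem_univ, true_and] at hz
    have hne : z.1 ≠ z.2 := fun h ↦ hz.2.1 (h ▸ hz.1)
    exact le_card_filter_reachable C hC hne (hΓ _ _ hne)
  have hSpos : 0 < S.card := Finset.card_pos.2 ⟨u, by simp [hS, hu]⟩
  have hTpos : 0 < T.card := Finset.card_pos.2 ⟨v, by simp [hT, hv, hva]⟩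
  have hsum := Finset.sum_le_sum hcolor
  rw [← Finset.mul_sum, ← Finset.mul_sum, Finset.sum_sub_distrib, Finset.sum_const, nsmul_one]
    at hsum
  have hm : (∑ c ∈ C, ((Γ.labelGraph c).edgeSet.ncard : ℤ)) ≤ G.edgeSet.ncard := by
    exact_mod_cast sum_ncard_edgeSet_labelGraph_le (Γ := Γ) C
  have hpairs' : ((S.card : ℤ) * T.card) * k ≤ ∑ c ∈ C, ((S' c).card : ℤ) * (T' c).card := by
    exact_mod_cast hpairs
  have hαβ : (0 : ℤ) < S.card * T.card := by positivity
  have hα : (0 : ℤ) ≤ (S.card : ℤ) + T.card - 1 := by omega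
  have hfin : ((S.card : ℤ) * T.card) * (((S.card : ℤ) + T.card - 1) * k) ≤
      ((S.card : ℤ) * T.card) * (G.edgeSet.ncard - C.card) :=
    calc ((S.card : ℤ) * T.card) * (((S.card : ℤ) + T.card - 1) * k)
        = ((S.card : ℤ) + T.card - 1) * (((S.card : ℤ) * T.card) * k) := by ring
      _ ≤ _ := mul_le_mul_of_nonneg_left hpairs' hα
      _ ≤ _ := hsum
      _ ≤ _ := mul_le_mul_of_nonneg_left (by linarith) hαβ.le
  have hfin' := le_of_mul_le_mul_left hfin hαβ
  rw [← hC, Set.ncard_coe_finset, ← hST]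
  zify
  linarith

theorem ncard_range_le_of_isCutVertex {V : Type*} [Finite V] {G : SimpleGraph V} {k : ℕ}
    {Γ : G.EdgeLabeling ℕ} (hΓ : IsRMCColoring G k Γ) {a : V} (ha : IsCutVertex G a) :
    (Set.range Γ).ncard + k * Nat.card V ≤ G.edgeSet.ncard + 2 * k := by
  obtain ⟨u, v, -, huv⟩ := ha
  refine ncard_range_le_of_separated hΓ (a := a) (u := u) (v := v)
    (A := {w | ∃ h : w ∈ ({a}ᶜ : Set V), (G.induce ({a}ᶜ : Set V)).Reachable u ⟨w, h⟩})
    ?_ ?_ ⟨u.2, .rfl⟩ (fun ⟨_, h⟩ ↦ huv h) v.2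
  · rintro x ⟨hx, hux⟩ y hxy
    by_cases hy : y = a
    · exact .inr hy
    · exact .inl ⟨hy, hux.trans (Adj.reachable (by simpa using hxy))⟩
  · rintro ⟨h, -⟩
    exact h rfl

/-! ### Small edge cuts -/

/-- The `k` colors connecting two vertices on different sides of a cut of at most `k` edges are
exactly the colors of the cut. So each of them connects every vertex on one side to every vertex on
the other, and therefore is spanning and connected. -/
theorem ncard_range_le_of_not_isEdgeConnected {V : Type*} [Finite V] {G : SimpleGraph V} {k : ℕ}
    {Γ : G.EdgeLabeling ℕ} (hΓ : IsRMCColoring G k Γ) (hG : ¬ G.IsEdgeConnected (k + 1)) :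
    (Set.range Γ).ncard + k * Nat.card V ≤ G.edgeSet.ncard + 2 * k := by
  classical
  have := Fintype.ofFinite V
  set C := (Set.finite_range Γ).toFinset
  have hC : (C : Set ℕ) = Set.range Γ := Set.Finite.coe_toFinset _
  simp only [IsEdgeConnected, IsEdgeReachable, not_forall] at hG
  obtain ⟨u, v, s, hs, huv⟩ := hG
  have hsk : s.ncard ≤ k := by
    rw [← (Set.toFinite s).cast_ncard_eq] at hs
    have : s.ncard < k + 1 := by exact_mod_cast hs
    omega
  set K := C.filter fun c ↦ ∃ e ∈ s, e ∈ (Γ.labelGraph c).edgeSet with hK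
  have hKs : K.card ≤ k := by
    refine le_trans ?_ hsk
    have hex : ∀ c, ∃ e, c ∈ K → e ∈ s ∧ e ∈ (Γ.labelGraph c).edgeSet := fun c ↦ by
      by_cases hc : c ∈ K
      · obtain ⟨e, he⟩ := (Finset.mem_filter.1 hc).2
        exact ⟨e, fun _ ↦ he⟩
      · exact ⟨s(u, u), fun h ↦ absurd h hc⟩
    choose e he using hex
    rw [← Set.ncard_coe_finset]
    refine Set.ncard_le_ncard_of_injOn e (fun c hc ↦ (he c hc).1) (fun c hc d hd hcd ↦ ?_)
      (Set.toFinite _)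
    obtain ⟨h1, h2⟩ := mem_edgeSet_labelGraph.1 (he c hc).2
    obtain ⟨h3, h4⟩ := mem_edgeSet_labelGraph.1 (he d hd).2
    rw [← h2, ← h4]
    simp only [hcd]
  have hcross {p q : V} (hpq : ¬ (G.deleteEdges s).Reachable p q) :
      (C.filter fun c ↦ (Γ.labelGraph c).Reachable p q) = K := by
    have hne : p ≠ q := by rintro rfl; exact hpq .rfl
    refine Finset.eq_of_subset_of_card_le (fun c hc ↦ ?_)
      (hKs.trans (le_card_filter_reachable C hC hne (hΓ p q hne)))
    obtain ⟨hcC, hr⟩ := Finset.mem_filter.1 hc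
    refine Finset.mem_filter.2 ⟨hcC, ?_⟩
    by_contra! hno
    refine hpq (hr.mono fun x y hxy ↦ ?_)
    rw [deleteEdges_adj]
    exact ⟨Γ.labelGraph_le hxy, fun h ↦ hno _ h hxy⟩
  have hne : u ≠ v := by rintro rfl; exact huv .rfl
  have hkK : k ≤ K.card := hcross huv ▸ le_card_filter_reachable C hC hne (hΓ u v hne)
  have hreach {c : ℕ} (hc : c ∈ K) {p q : V} (hpq : ¬ (G.deleteEdges s).Reachable p q) :
      (Γ.labelGraph c).Reachable p q := by
    rw [← hcross hpq] at hc
    exact (Finset.mem_filter.1 hc).2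
  have hconn {c : ℕ} (hc : c ∈ K) (p : V) : (Γ.labelGraph c).Reachable p u := by
    by_cases hp : (G.deleteEdges s).Reachable u p
    · exact (hreach hc fun h ↦ huv (hp.trans h)).trans (hreach hc huv).symm
    · exact (hreach hc hp).symm
  have h2 : 2 ≤ Nat.card V := by
    rw [Nat.card_eq_fintype_card]
    exact Fintype.one_lt_card_iff.2 ⟨u, v, hne⟩
  have h1 := ncard_range_add_sum_le C hC (fun c ↦ if c ∈ K then Nat.card V - 2 else 0)
    (fun c hc ↦ by
      split_ifs with hcK
      · have := card_le_ncard_edgeSet_of_roots (H := Γ.labelGraph c) (Finset.univ.erase u)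
          (fun _ ↦ u) (fun w hw ↦ Finset.ne_of_mem_erase hw) (fun w _ ↦ hconn hcK w)
          (fun _ _ _ _ _ ↦ rfl)
        rw [Finset.card_erase_of_mem (Finset.mem_univ _), Finset.card_univ,
          ← Nat.card_eq_fintype_card] at this
        omega
      · exact (Set.ncard_pos).2 (nonempty_edgeSet_labelGraph (by rw [← hC]; exact hc)))
  rw [← Finset.sum_filter, Finset.filter_mem_eq_inter,
    Finset.inter_eq_right.2 (Finset.filter_subset _ _), Finset.sum_const, smul_eq_mul] at h1
  have h3 := Nat.mul_le_mul_right (Nat.card V - 2) hkK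
  obtain ⟨n, hn⟩ := Nat.exists_eq_add_of_le h2
  rw [hn] at h1 h3 ⊢
  rw [Nat.add_sub_cancel_left] at h1 h3
  nlinarith

theorem exists_pair_without_common_neighbor {V : Type*} [Nontrivial V] {G : SimpleGraph V}
    (hG : G.Preconnected) (h : G.CliqueFree 3 ∨ 3 ≤ G.ediam) :
    ∃ u v : V, u ≠ v ∧ ∀ w, G.Adj u w → ¬ G.Adj v w := by
  classical
  rcases h with h | h
  · obtain ⟨u⟩ : Nonempty V := inferInstance
    obtain ⟨v, huv⟩ := hG.exists_adj_of_nontrivial u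
    exact ⟨u, v, huv.ne, fun w huw hvw ↦
      h {u, v, w} (is3Clique_triple_iff.2 ⟨huv, huw, hvw⟩)⟩
  · by_contra! hcon
    refine absurd (h.trans (ediam_le_of_edist_le (k := 2) fun u v ↦ ?_)) (by decide)
    by_contra! hlt
    obtain ⟨hne, -, hemp⟩ := two_lt_edist_iff.1 hlt
    obtain ⟨w, huw, hvw⟩ := hcon u v hne
    exact (Set.eq_empty_iff_forall_notMem.1 hemp w) ⟨huw, hvw⟩

end RainbowMono

theorem theorem4p1 {V : Type*} [Finite V] [Nontrivial V] (G : SimpleGraph V) (k : ℕ)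
    (hk : 1 ≤ k) (hτ : (k : ℝ) ≤ RainbowMono.tau G)
    (h : G.CliqueFree 3 ∨ 3 ≤ G.ediam ∨ (∃ a : V, RainbowMono.IsCutVertex G a) ∨
      ¬ G.IsEdgeConnected (k + 1)) :
    IsGreatest (RainbowMono.rmcColorCounts G k) (RainbowMono.rmc G k) ∧
      (RainbowMono.rmc G k : ℤ) =
        (G.edgeSet.ncard : ℤ) - (k : ℤ) * ((Nat.card V : ℤ) - 2) := by
  obtain ⟨φ, hφ⟩ := RainbowMono.exists_forall_edgeClass_connected G hk
    (RainbowMono.mul_card_quotient_le_of_le_tau hτ)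
  have hG : G.Preconnected :=
    ((hφ ⟨0, hk⟩).mono fun _ _ ↦ And.left).preconnected
  have hupper (Γ : G.EdgeLabeling ℕ) (hΓ : RainbowMono.IsRMCColoring G k Γ) :
      (Set.range Γ).ncard + k * Nat.card V ≤ G.edgeSet.ncard + 2 * k := by
    have hpair (h' : G.CliqueFree 3 ∨ 3 ≤ G.ediam) :
        (Set.range Γ).ncard + k * Nat.card V ≤ G.edgeSet.ncard + 2 * k := by
      obtain ⟨u, v, huv, hno⟩ := RainbowMono.exists_pair_without_common_neighbor hG h'
      exact RainbowMono.ncard_range_le_of_no_common_neighbor hΓ huv hno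
    rcases h with h | h | ⟨a, ha⟩ | h
    · exact hpair (.inl h)
    · exact hpair (.inr h)
    · exact RainbowMono.ncard_range_le_of_isCutVertex hΓ ha
    · exact RainbowMono.ncard_range_le_of_not_isEdgeConnected hΓ h
  obtain ⟨Γ, hΓ, hlower⟩ := RainbowMono.exists_isRMCColoring_of_connected G φ hφ
  have heq := le_antisymm (hupper Γ hΓ) hlower
  have hgreatest : IsGreatest (RainbowMono.rmcColorCounts G k) (Set.range Γ).ncard := by
    refine ⟨⟨Γ, hΓ, rfl⟩, ?_⟩
    rintro _ ⟨Γ', hΓ', rfl⟩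
    have := hupper Γ' hΓ'
    omega
  have hrmc : RainbowMono.rmc G k = (Set.range Γ).ncard := hgreatest.csSup_eq
  rw [hrmc]
  refine ⟨hgreatest, ?_⟩
  zify at heq
  linarith
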